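/- An inversion sequence of length $n$ is an integer sequence $e=(e_1,\dots,e_n)$ with $0\le e_j\le j-1$ for $1\le j\le n$ (for $n=0$ there is exactly one, the empty sequence). It contains a pattern $w=w_1\cdots w_k$ if there are indices $i_1<\dots<i_k$ such that replacing, for each $i$, the $i$-th smallest value occurring in $e_{i_1}\cdots e_{i_k}$ by $i-1$ gives $w$; otherwise it avoids $w$. Let $\mathcal{IS}_n^{(m)}(102,000)$ be the set of inversion sequences $e$ of length $n$ that avoid both $102$ and $000$ and have exactly $m$ distinct elements, i.e. $|\{e_1,\dots,e_n\}|=m$. Then the generating function $$E=\sum_{n\ge 0}\sum_{m\ge 0}\bigl|\mathcal{IS}_n^{(m)}(102,000)\bigr|\,y^m x^n\in\mathbb{Q}[[x,y]]$$ is algebraic over $\mathbb{Q}(x,y)$, and its minimal polynomial is, in the variable $T$, $$P(T)=1-\bigl(1-2yx(1-x)\bigr)T+yx\bigl(-1+3x+yx(1-x)^2\bigr)T^2+2y^2x^3(1-x)T^3+y^2x^4T^4 .$$ That is, $P$ is irreducible in $\mathbb{Q}[x,y][T]$, $P(E)=0$, and $P$ equals its leading coefficient $y^2x^4$ times the monic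 minimal polynomial of $E$ over $\mathbb{Q}(x,y)$. -/

import Mathlib

/-- The reduction of a word `u` of natural numbers of length `k`: the `i`-th smallest of the values
occurring in `u` is replaced by `i - 1`. So each letter becomes the number of distinct smaller
values that occur in `u`. -/
def wordReduction {k : ℕ} (u : Fin k → ℕ) : Fin k → ℕ :=
  fun j => ((Finset.univ.image u).filter (fun v => v < u j)).card

/-- The sequence `e` contains the pattern `w`: some subsequence of `e` has reduction `w`. -/
def ContainsPattern {n k : ℕ} (e : Fin n → ℕ) (w : Fin k → ℕ) : Prop :=
  ∃ i : Fin k → Fin n, StrictMono i ∧ wordReduction (fun j => e (i j)) = w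

/-- Inversion sequences of length `n`; with indices starting from `0` the condition
`0 ≤ e_j ≤ j - 1` for `1 ≤ j ≤ n` reads `e j ≤ j` for `j < n`. -/
def IsInversionSeq {n : ℕ} (e : Fin n → ℕ) : Prop :=
  ∀ j : Fin n, e j ≤ (j : ℕ)

/-- The number of distinct elements of a sequence. -/
def seqDist {n : ℕ} (e : Fin n → ℕ) : ℕ :=
  (Finset.univ.image e).card

/-- The set of `(102, 000)`-avoiding inversion sequences of length `n` with exactly `m` distinct
elements. -/
def avoidingInvSeq (n m : ℕ) : Set (Fin n → ℕ) :=
  {e | IsInversionSeq e ∧ ¬ ContainsPattern e ![1, 0, 2] ∧ ¬ ContainsPattern e ![0, 0, 0] ∧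
    seqDist e = m}

theorem avoidingInvSeq_finite (n m : ℕ) : (avoidingInvSeq n m).Finite :=
  (Set.finite_Iic (fun j : Fin n => (j : ℕ))).subset fun _ he => he.1

/-- The generating function `E = ∑ₙ ∑ₘ |IS_n^(m)(102,000)| y^m x^n` as a formal power series, where
the variable with index `0` is `x` and the variable with index `1` is `y`. -/
noncomputable def genE : MvPowerSeries (Fin 2) ℚ :=
  fun s => ((avoidingInvSeq (s 0) (s 1)).ncard : ℚ)

/-- The polynomial
`1 - (1 - 2yx(1-x)) T + yx(-1 + 3x + yx(1-x)²) T² + 2y²x³(1-x) T³ + y²x⁴ T⁴`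
in `T` with coefficients in `ℚ[x, y]`. -/
noncomputable def polyE : Polynomial (MvPolynomial (Fin 2) ℚ) :=
  let x : MvPolynomial (Fin 2) ℚ := MvPolynomial.X 0
  let y : MvPolynomial (Fin 2) ℚ := MvPolynomial.X 1
  let T : Polynomial (MvPolynomial (Fin 2) ℚ) := Polynomial.X
  1 - Polynomial.C (1 - 2 * y * x * (1 - x)) * T
    + Polynomial.C (y * x * (-1 + 3 * x + y * x * (1 - x) ^ 2)) * T ^ 2
    + Polynomial.C (2 * y ^ 2 * x ^ 3 * (1 - x)) * T ^ 3
    + Polynomial.C (y ^ 2 * x ^ 4) * T ^ 4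

/-- The field `ℚ(x, y)` of rational functions. -/
abbrev RatField : Type := FractionRing (MvPolynomial (Fin 2) ℚ)

/-- The fraction field of the ring `ℚ⟦x, y⟧` of formal power series. -/
abbrev SeriesField : Type := FractionRing (MvPowerSeries (Fin 2) ℚ)

instance polySeriesFaithful :
    FaithfulSMul (MvPolynomial (Fin 2) ℚ) (MvPowerSeries (Fin 2) ℚ) := by
  rw [faithfulSMul_iff_algebraMap_injective]
  intro p q h
  simpa [MvPowerSeries.algebraMap_apply'] using h

/-- `ℚ(x, y)` as a subfield of the fraction field of `ℚ⟦x, y⟧`: the embedding extends the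
inclusion of `ℚ[x, y]` in `ℚ⟦x, y⟧`. -/
noncomputable instance ratFieldAlgebra : Algebra RatField SeriesField :=
  FractionRing.liftAlgebra (MvPolynomial (Fin 2) ℚ) SeriesField

instance ratFieldTower : IsScalarTower (MvPolynomial (Fin 2) ℚ) RatField SeriesField :=
  FractionRing.isScalarTower_liftAlgebra (MvPolynomial (Fin 2) ℚ) SeriesField

/-! Write a nonempty word avoiding both patterns as `a P Q`, where `a` is the first letter and `Q`
starts at the first letter below `a`. Avoiding 102 forces every letter of `Q` to be at most `a`;
conversely, if `P` lies weakly above `a` and `Q` weakly below, no 102 arises across the pieces.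
Avoiding 000 lets `a` recur at most once. So `P` and `Q` are independent words for which `a` is the
smallest, respectively largest, admissible letter, with multiplicity 0 or 1. This is why the classes
mark the multiplicities of their extreme letters. Words in an interval (`boxGF`) satisfy a quadratic
recursion. Words under the staircase bound (`slackGF`) satisfy a linear one with box coefficients,
because the bound only matters for `P`.

Let `t` mark the number of letters. The four box series a, b, c, d then satisfy algebraic equations,
and the two slack series satisfy a linear system whose only other unknown is E, which is free of
`t`. Eliminating one slack series S₁ gives S₀ · g · (1 - t) = t(1 - xb) - x²yEa(1 - t) with a kernel
g congruent to `t` modulo `x`. Setting g = 0, `quartic_of_kernel` finds x²yE = t(1 - t) and t(1 -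
t)((1 - t)² - xy(1 - x)) = x²y. Eliminating `t` gives (1 + xy(1 - x)E + x²yE²)² = E(1 + xy(1 - x)E),
which is P(E) = 0. Rather than substituting a root of g, the proof computes modulo g and returns to
power series in x, y by `pow_dvd_of_C_eq_mul`.

Irreducibility follows from the specialisation x = y = 1, which modulo 2 is T⁴ + T + 1. -/

/-! ### Elimination on the zero locus of the kernel -/

/-- The consequence of the functional equations on the zero locus of the kernel. -/
theorem quartic_of_kernel {Q : Type*} [CommRing Q] {x y t E a b c d : Q}
    (ht : IsUnit (1 - t)) (hu : IsUnit (1 - t * (x * b)))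
    (h1 : (1 - t) * a = 1 + (1 - t) * (t * (x * y * a * a + x * b * a + x * a * (c - x * y * a))))
    (h2 : b = x * y * a + t * (x * y * a * b + x * b * b + x * a * (d - x * y * b)))
    (h3 : c - x * y * a = t * (x * y * c * a + x * d * a + x * c * (c - x * y * a)))
    (h4 : d - x * y * b =
      x * y * c + t * (x * y * c * b + x * d * b + x * c * (d - x * y * b)))
    (hK : t * (1 - (x * y * a + x * (c - x * y * a))) * (1 - x * b) =
      x * a * (x * y + t * (x * y * b + x * (d - x * y * b))))
    (hE : x ^ 2 * y * E * a * (1 - t) = t * (1 - x * b)) :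
    (x ^ 2 * y) ^ 2 * ((1 + x * y * (1 - x) * E + x ^ 2 * y * E * E) ^ 2 -
      E * (1 + x * y * (1 - x) * E)) = 0 := by
  set α := x * y * a + x * (c - x * y * a) with hα
  have e1 : a * (1 - t * α - t * (x * b)) * (1 - t) = 1 := by
    rw [hα]; linear_combination h1
  have ha : IsUnit a := IsUnit.of_mul_eq_one ((1 - t * α - t * (x * b)) * (1 - t)) (by
    linear_combination e1)
  -- By `h2`, the second term of the kernel is `x * b * (1 - t * (x * b))`, so `d` drops out.
  have hK' : t * (1 - α) * (1 - x * b) = x * b * (1 - t * (x * b)) := by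
    linear_combination hK - x * h2
  have e2 : (1 - x * b) * (1 - t * α - t * (x * b)) = 1 - t := by
    linear_combination hK'
  have e3 : 1 - x * b = a * (1 - t) ^ 2 := by
    linear_combination a * (1 - t) * e2 - (1 - x * b) * e1
  have e4 : x ^ 2 * y * E = t * (1 - t) := by
    linear_combination (1 - t * α - t * (x * b)) * hE - x ^ 2 * y * E * e1 + t * e2
  -- The determinant `a * d - c * b` satisfies a linear equation; it serves to eliminate `d`.
  have e5 : a * d * (1 - t * (x * b)) = c * b * (1 - t * (x * b)) + x * y * a * b := by
    linear_combination a * h4 - c * h2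
  have e6 : c * (1 - t * (x * b)) = x * y * a ^ 2 * (1 - t) := by
    rw [hα] at e1
    linear_combination a * (1 - t) * (1 - t * (x * b)) * h3 + a * (1 - t) * t * x * e5 -
      c * (1 - t * (x * b)) * e1
  have e7 : x ^ 2 * y * a ^ 2 * (1 - t) = x * b * (1 - t * (x * b)) := by
    rw [hα] at e1
    linear_combination -x * a * (1 - t) * (1 - t * (x * b)) * h2 - x * a * (1 - t) * t * x * e5 +
      x * b * (1 - t * (x * b)) * e1
  -- This symmetry of the two marked ends does not use the kernel: `e6` and `e7` rest on `h1`–`h4`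
  -- alone.
  have e8 : x * c = x * b := hu.mul_right_cancel (by linear_combination x * e6 + e7)
  have e9 : t * (1 - t) * (1 - α) = x ^ 2 * y * a := by
    refine (ha.mul ht).mul_right_cancel ?_
    linear_combination hK' - e7 - t * (1 - α) * e3
  have e10 : 1 - α = a * ((1 - t) ^ 2 - x * y * (1 - x)) := by
    rw [hα]; linear_combination e3 - e8
  -- All box series are now gone: this is an equation for `t` over x and y.
  have e11 : t * (1 - t) * ((1 - t) ^ 2 - x * y * (1 - x)) = x ^ 2 * y := by
    refine ha.mul_right_cancel ?_
    linear_combination e9 - t * (1 - t) * e10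
  have e12 : x ^ 2 * y * (1 + x * y * (1 - x) * E) = x ^ 2 * y * E * (1 - t) ^ 2 := by
    linear_combination -e11 + (-(1 - t) ^ 2 + x * y * (1 - x)) * e4
  have e13 : x ^ 2 * y * (1 + x * y * (1 - x) * E + x ^ 2 * y * E * E) =
      x ^ 2 * y * E * (1 - t) := by
    linear_combination e12 + x ^ 2 * y * E * e4
  -- Up to the factor x²y, `e12` and `e13` express E(1 - t)² and E(1 - t) without `t`; compare the
  -- square of the second with E times the first.
  linear_combination (x ^ 2 * y * (1 + x * y * (1 - x) * E + x ^ 2 * y * E * E) +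
    x ^ 2 * y * E * (1 - t)) * e13 - x ^ 2 * y * E * e12

/-! ### Returning from the quotient by the kernel -/

/-- An element of `R` that becomes a multiple of `t + x k` in `R⟦t⟧` is divisible by all powers of
`x`. -/
theorem pow_dvd_of_C_eq_mul {R : Type*} [CommRing R] [IsDomain R] {x : R} (hx : x ≠ 0)
    (k : PowerSeries R) (n : ℕ) : ∀ (r : R) (h : PowerSeries R),
      PowerSeries.C r = (PowerSeries.X + PowerSeries.C x * k) * h → x ^ n ∣ r := by
  induction n with
  | zero => intro r h _; simp
  | succ n ih =>
    intro r h e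
    -- The left side is constant in `t`, so its coefficient at `m + 1` vanishes and the coefficient
    -- of `h` at `m` is a multiple of `x`. Then `r` is one too, and cancelling `x` allows induction.
    have hd : ∀ m, x ∣ PowerSeries.coeff m h := by
      intro m
      have := congrArg (PowerSeries.coeff (m + 1)) e
      rw [add_mul, map_add, PowerSeries.coeff_succ_X_mul, mul_assoc, PowerSeries.coeff_C_mul,
        PowerSeries.coeff_C, if_neg (Nat.succ_ne_zero m)] at this
      exact ⟨-PowerSeries.coeff (m + 1) (k * h), by linear_combination -this⟩
    choose h' hh' using hd
    have eh : h = PowerSeries.C x * PowerSeries.mk h' := by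
      ext m; simp [hh']
    have er : r = x * PowerSeries.coeff 0 (k * h) := by
      have := congrArg (PowerSeries.coeff 0) e
      simpa [add_mul, mul_assoc] using this
    obtain ⟨r', hr'⟩ : ∃ r', r = x * r' := ⟨_, er⟩
    subst hr'
    rw [pow_succ']
    refine mul_dvd_mul_left x (ih r' (PowerSeries.mk h') ?_)
    have hCx : (PowerSeries.C x : PowerSeries R) ≠ 0 := by
      intro h0; exact hx (PowerSeries.C_injective (by simpa using h0))
    refine mul_left_cancel₀ hCx ?_
    rw [eh, map_mul] at e
    linear_combination e

theorem eq_zero_of_X_pow_dvd {r : MvPowerSeries (Fin 2) ℚ}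
    (h : ∀ n : ℕ, (MvPowerSeries.X 0 : MvPowerSeries (Fin 2) ℚ) ^ n ∣ r) : r = 0 := by
  ext s
  have := MvPowerSeries.X_pow_dvd_iff.1 (h (s 0 + 1)) s (Nat.lt_succ_self _)
  simpa using this

/-! ### Irreducibility and the minimal polynomial -/

open Polynomial in
theorem irreducible_quartic_zmod :
    Irreducible (X ^ 4 + 2 * X ^ 2 - X + 1 : (ZMod 2)[X]) := by
  have e : (X ^ 4 + 2 * X ^ 2 - X + 1 : (ZMod 2)[X]) = X ^ 4 + X + 1 := by
    have h2 : (2 : (ZMod 2)[X]) = 0 := CharTwo.two_eq_zero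
    linear_combination (X ^ 2 - X) * h2
  rw [e]
  have hm : (X ^ 4 + X + 1 : (ZMod 2)[X]).Monic := by monicity!
  have hd : (X ^ 4 + X + 1 : (ZMod 2)[X]).natDegree = 4 := by compute_degree!
  rw [hm.irreducible_iff_lt_natDegree_lt (by
    intro h; rw [h] at hd; simp at hd)]
  intro q hq hqd hdvd
  rw [hd] at hqd
  have hq' : q.natDegree = 1 ∨ q.natDegree = 2 := by
    have := Finset.mem_Ioc.1 hqd; omega
  obtain ⟨r, hr⟩ := hdvd
  have hr' : r.Monic := hq.of_mul_monic_left (hr ▸ hm)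
  have hdr : q.natDegree + r.natDegree = 4 := by
    rw [← hd, hr, hq.natDegree_mul hr']
  rcases hq' with h1 | h2
  · have hc : q = X + C (q.coeff 0) := hq.eq_X_add_C h1
    -- A linear factor would give a root in the field with two elements.
    have := congrArg (eval (-(q.coeff 0))) hr
    rw [eval_mul, hc] at this
    simp only [eval_add, eval_pow, eval_X, eval_one, eval_C, coeff_add, coeff_X_zero, coeff_C_zero,
      zero_add, neg_add_cancel, zero_mul] at this
    generalize q.coeff 0 = z at this
    revert z
    decide
  · have expand : ∀ p : (ZMod 2)[X], p.Monic → p.natDegree = 2 →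
        p = X ^ 2 + C (p.coeff 1) * X + C (p.coeff 0) := by
      intro p hp hp2
      conv_lhs => rw [p.as_sum_range_C_mul_X_pow, hp2]
      have : p.coeff 2 = 1 := by simpa [hp2] using hp.coeff_natDegree
      simp [Finset.sum_range_succ, this]
      ring
    have eq := expand q hq h2
    have er := expand r hr' (by omega)
    generalize q.coeff 0 = c at eq
    generalize q.coeff 1 = b at eq
    generalize r.coeff 0 = f at er
    generalize r.coeff 1 = e at er
    -- Two monic quadratics leave four unknown bits, and comparing coefficients reduces the claim to
    -- a finite check.
    have hmul : (X ^ 4 + X + 1 : (ZMod 2)[X]) = X ^ 4 + C (b + e) * X ^ 3 +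
        C (c + f + b * e) * X ^ 2 + C (b * f + c * e) * X + C (c * f) := by
      rw [hr, eq, er]; simp only [map_add, map_mul]; ring
    have c0 := congrArg (coeff · 0) hmul
    have c1 := congrArg (coeff · 1) hmul
    have c2 := congrArg (coeff · 2) hmul
    have c3 := congrArg (coeff · 3) hmul
    simp [coeff_X, coeff_one, -map_add, -map_mul, coeff_C] at c0 c1 c2 c3
    clear hmul eq er
    revert b c e f
    decide

open Polynomial in
theorem irreducible_quartic_rat :
    Irreducible (X ^ 4 + 2 * X ^ 2 - X + 1 : ℚ[X]) := by
  have hm : (X ^ 4 + 2 * X ^ 2 - X + 1 : ℤ[X]).Monic := by monicity!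
  have h : Irreducible (X ^ 4 + 2 * X ^ 2 - X + 1 : ℤ[X]) := by
    refine hm.irreducible_of_irreducible_map (Int.castRingHom (ZMod 2)) _ ?_
    simpa using irreducible_quartic_zmod
  simpa using (hm.irreducible_iff_irreducible_map_fraction_map (K := ℚ)).1 h

open Polynomial in
/-- A polynomial with constant coefficient `1` is irreducible if it has an irreducible image of the
same degree. -/
theorem irreducible_of_map_of_coeff_zero {R K : Type*} [CommRing R] [IsDomain R] [Field K]
    (φ : R →+* K) {P : R[X]} (h0 : P.coeff 0 = 1) (hd : (P.map φ).natDegree = P.natDegree)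
    (hi : Irreducible (P.map φ)) : Irreducible P := by
  have key : ∀ f g : R[X], P = f * g → IsUnit (f.map φ) → IsUnit f := by
    intro f g hfg hu
    have hP : P ≠ 0 := by rintro rfl; simp at h0
    have hf : f ≠ 0 := by rintro rfl; simp at hfg; exact hP hfg
    have hg : g ≠ 0 := by rintro rfl; simp at hfg; exact hP hfg
    have h1 : (P.map φ).natDegree = (f.map φ).natDegree + (g.map φ).natDegree := by
      have hne := hi.ne_zero
      rw [hfg, Polynomial.map_mul] at hne ⊢
      exact natDegree_mul (left_ne_zero_of_mul hne) (right_ne_zero_of_mul hne)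
    have h2 : P.natDegree = f.natDegree + g.natDegree := by
      rw [hfg]; exact natDegree_mul hf hg
    have h3 : (f.map φ).natDegree = 0 := natDegree_eq_zero_of_isUnit hu
    have h4 : (g.map φ).natDegree ≤ g.natDegree := natDegree_map_le
    -- Degrees cannot grow under the map but their sum is preserved, so `f` keeps its degree. A
    -- constant factor is then a unit because it divides the constant coefficient 1.
    have h5 : f.natDegree = 0 := by omega
    rw [eq_C_of_natDegree_eq_zero h5]
    refine (IsUnit.of_mul_eq_one (g.coeff 0) ?_).map C
    rw [← mul_coeff_zero, ← hfg, h0]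
  refine ⟨fun h => hi.not_isUnit (h.map (mapRingHom φ)), fun f g hfg => ?_⟩
  have := hi.isUnit_or_isUnit (a := f.map φ) (b := g.map φ) (by rw [hfg, Polynomial.map_mul])
  rcases this with h | h
  · exact Or.inl (key f g hfg h)
  · exact Or.inr (key g f (by rw [hfg, mul_comm]) h)

open Polynomial in
theorem polyE_coeff_zero : polyE.coeff 0 = 1 := by
  simp [polyE, coeff_one, coeff_X, coeff_X_pow]

open Polynomial in
theorem polyE_natDegree : polyE.natDegree = 4 := by
  have key : ∀ a b c d : MvPolynomial (Fin 2) ℚ, d ≠ 0 →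
      (1 - C a * X + C b * X ^ 2 + C c * X ^ 3 + C d * X ^ 4).natDegree = 4 := by
    intro a b c d hd
    compute_degree!
  exact key _ _ _ _ (by simp [MvPolynomial.X_ne_zero])

open Polynomial in
theorem irreducible_polyE : Irreducible polyE := by
  have e : polyE.map (MvPolynomial.eval (fun _ => (1 : ℚ))) = X ^ 4 + 2 * X ^ 2 - X + 1 := by
    have h3 : (C 3 : ℚ[X]) = 3 := rfl
    simp [polyE, h3]
    ring
  refine irreducible_of_map_of_coeff_zero (MvPolynomial.eval (fun _ => (1 : ℚ)))
    polyE_coeff_zero ?_ ?_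
  · rw [e, polyE_natDegree]; compute_degree!
  · rw [e]; exact irreducible_quartic_rat

theorem isAlgebraic_and_map_polyE_of_aeval_eq_zero {E : MvPowerSeries (Fin 2) ℚ} (h : Polynomial.aeval E polyE = 0) :
    IsAlgebraic RatField (algebraMap (MvPowerSeries (Fin 2) ℚ) SeriesField E) ∧
    Polynomial.map (algebraMap (MvPolynomial (Fin 2) ℚ) RatField) polyE =
      Polynomial.C (algebraMap (MvPolynomial (Fin 2) ℚ) RatField polyE.leadingCoeff) *
        minpoly RatField (algebraMap (MvPowerSeries (Fin 2) ℚ) SeriesField E) := by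
  set ι := algebraMap (MvPolynomial (Fin 2) ℚ) RatField with hι
  have hinj : Function.Injective ι := IsFractionRing.injective _ _
  have h0 : Polynomial.aeval (algebraMap (MvPowerSeries (Fin 2) ℚ) SeriesField E)
      (polyE.map ι) = 0 := by
    rw [Polynomial.aeval_map_algebraMap, Polynomial.aeval_algebraMap_apply, h, map_zero]
  have hirr : Irreducible (polyE.map ι) := by
    -- A constant divisor divides the constant coefficient 1, so Gauss's lemma applies.
    have hp : polyE.IsPrimitive := by
      intro r hr
      obtain ⟨q, hq⟩ := hr
      refine IsUnit.of_mul_eq_one (q.coeff 0) ?_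
      rw [← Polynomial.coeff_C_mul, ← hq, polyE_coeff_zero]
    exact (hp.irreducible_iff_irreducible_map_fraction_map).1 irreducible_polyE
  refine ⟨⟨_, hirr.ne_zero, h0⟩, ?_⟩
  have hl : (polyE.map ι).leadingCoeff = ι polyE.leadingCoeff :=
    Polynomial.leadingCoeff_map_of_injective hinj _
  have hl0 : ι polyE.leadingCoeff ≠ 0 := by
    rw [← hl]; exact Polynomial.leadingCoeff_ne_zero.2 hirr.ne_zero
  rw [← minpoly.eq_of_irreducible hirr h0, hl, mul_left_comm, ← Polynomial.C_mul,
    mul_inv_cancel₀ hl0, Polynomial.C_1, mul_one]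

/-! ### Generating functions of weighted sets -/

/-- The generating function of a set `S` whose elements `a` have the weight
`x ^ (w a) 0 * y ^ (w a) 1`. -/
noncomputable def weightGF {α : Type*} (w : α → Fin 2 →₀ ℕ) (S : Set α) :
    MvPowerSeries (Fin 2) ℚ :=
  fun d => ((S ∩ w ⁻¹' {d}).ncard : ℚ)

theorem coeff_weightGF {α : Type*} (w : α → Fin 2 →₀ ℕ) (S : Set α) (d : Fin 2 →₀ ℕ) :
    MvPowerSeries.coeff d (weightGF w S) = ((S ∩ w ⁻¹' {d}).ncard : ℚ) := rfl

/-- Every weight is attained finitely often. -/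
def FiniteFibers {α : Type*} (w : α → Fin 2 →₀ ℕ) (S : Set α) : Prop :=
  ∀ d, (S ∩ w ⁻¹' {d}).Finite

theorem FiniteFibers.mono {α : Type*} {w : α → Fin 2 →₀ ℕ} {S T : Set α} (h : FiniteFibers w T)
    (hST : S ⊆ T) : FiniteFibers w S :=
  fun d => (h d).subset (Set.inter_subset_inter_left _ hST)

theorem weightGF_empty {α : Type*} (w : α → Fin 2 →₀ ℕ) : weightGF w ∅ = 0 := by
  ext d; simp [coeff_weightGF]

theorem weightGF_singleton {α : Type*} {w : α → Fin 2 →₀ ℕ} {a : α} (h : w a = 0) :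
    weightGF w {a} = 1 := by
  ext d
  rw [coeff_weightGF, MvPowerSeries.coeff_one]
  split_ifs with hd
  · have : ({a} ∩ w ⁻¹' {d} : Set α) = {a} := by
      rw [Set.inter_eq_left]; simp [h, hd]
    simp [this]
  · have : ({a} ∩ w ⁻¹' {d} : Set α) = ∅ := by
      ext b; simp; rintro rfl; rw [h]; exact fun h => hd h.symm
    simp [this]

/-- Finite fibres are essential, since `ncard` gives infinite sets the value 0 and is not additive
there. -/
theorem weightGF_union {α : Type*} {w : α → Fin 2 →₀ ℕ} {S T : Set α} (hS : FiniteFibers w S)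
    (hT : FiniteFibers w T) (hd : Disjoint S T) :
    weightGF w (S ∪ T) = weightGF w S + weightGF w T := by
  ext d
  rw [map_add, coeff_weightGF, coeff_weightGF, coeff_weightGF, Set.union_inter_distrib_right,
    Set.ncard_union_eq (hd.mono Set.inter_subset_left Set.inter_subset_left) (hS d) (hT d)]
  push_cast; rfl

theorem FiniteFibers.union {α : Type*} {w : α → Fin 2 →₀ ℕ} {S T : Set α}
    (hS : FiniteFibers w S) (hT : FiniteFibers w T) : FiniteFibers w (S ∪ T) := by
  intro d
  rw [Set.union_inter_distrib_right]
  exact (hS d).union (hT d)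

theorem weightGF_biUnion {α ι : Type*} {w : α → Fin 2 →₀ ℕ} (s : Finset ι) (S : ι → Set α)
    (hS : ∀ i ∈ s, FiniteFibers w (S i))
    (hd : ∀ i ∈ s, ∀ j ∈ s, i ≠ j → Disjoint (S i) (S j)) :
    FiniteFibers w (⋃ i ∈ s, S i) ∧
      weightGF w (⋃ i ∈ s, S i) = ∑ i ∈ s, weightGF w (S i) := by
  classical
  induction s using Finset.induction_on with
  | empty => exact ⟨fun d => by simp, by simp [weightGF_empty]⟩
  | insert a s ha ih =>
    obtain ⟨h1, h2⟩ := ih (fun i hi => hS i (Finset.mem_insert_of_mem hi))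
      (fun i hi j hj => hd i (Finset.mem_insert_of_mem hi) j (Finset.mem_insert_of_mem hj))
    have ha' := hS a (Finset.mem_insert_self a s)
    rw [Finset.set_biUnion_insert, Finset.sum_insert ha]
    refine ⟨ha'.union h1, ?_⟩
    rw [weightGF_union ha' h1, h2]
    rw [Set.disjoint_iUnion₂_right]
    intro i hi
    exact hd a (Finset.mem_insert_self a s) i (Finset.mem_insert_of_mem hi)
      (fun h => ha (h ▸ hi))

theorem weightGF_prod {α β : Type*} {w : α → Fin 2 →₀ ℕ} {v : β → Fin 2 →₀ ℕ} {S : Set α}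
    {T : Set β} (hS : FiniteFibers w S) (hT : FiniteFibers v T) :
    weightGF (fun p : α × β => w p.1 + v p.2) (S ×ˢ T) = weightGF w S * weightGF v T := by
  classical
  ext d
  rw [MvPowerSeries.coeff_mul, coeff_weightGF]
  have e : ((S ×ˢ T) ∩ (fun p : α × β => w p.1 + v p.2) ⁻¹' {d}) =
      ((Finset.HasAntidiagonal.antidiagonal d).biUnion fun q =>
        (hS q.1).toFinset ×ˢ (hT q.2).toFinset : Finset (α × β)) := by
    ext ⟨a, b⟩
    simp only [Set.mem_inter_iff, Set.mem_prod, Set.mem_preimage, Set.mem_singleton_iff,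
      Finset.coe_biUnion, Set.mem_iUnion, Finset.mem_coe,
      Finset.HasAntidiagonal.mem_antidiagonal, exists_prop, Prod.exists, Finset.mem_product, Set.Finite.mem_toFinset]
    constructor
    · rintro ⟨⟨h1, h2⟩, h3⟩
      exact ⟨_, _, h3, ⟨h1, rfl⟩, h2, rfl⟩
    · rintro ⟨_, _, h3, ⟨h1, rfl⟩, h2, rfl⟩
      exact ⟨⟨h1, h2⟩, h3⟩
  rw [e, Set.ncard_coe_finset, Finset.card_biUnion, Nat.cast_sum]
  · refine Finset.sum_congr rfl fun q _ => ?_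
    rw [Finset.card_product, coeff_weightGF, coeff_weightGF, Set.ncard_eq_toFinset_card _ (hS q.1),
      Set.ncard_eq_toFinset_card _ (hT q.2), Nat.cast_mul]
  · intro q _ q' _ hne
    rw [Function.onFun, Finset.disjoint_left]
    rintro ⟨a, b⟩ h h'
    simp only [Finset.mem_product, Set.Finite.mem_toFinset, Set.mem_inter_iff, Set.mem_preimage,
      Set.mem_singleton_iff] at h h'
    exact hne (Prod.ext (h.1.2.symm.trans h'.1.2) (h.2.2.symm.trans h'.2.2))

theorem weightGF_bijOn {α β : Type*} {w : α → Fin 2 →₀ ℕ} {v : β → Fin 2 →₀ ℕ} {S : Set α}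
    {T : Set β} {f : α → β} (c : Fin 2 →₀ ℕ) (hf : Set.BijOn f S T)
    (hw : ∀ a ∈ S, v (f a) = c + w a) :
    weightGF v T = MvPowerSeries.monomial c 1 * weightGF w S := by
  ext d
  rw [MvPowerSeries.coeff_monomial_mul, coeff_weightGF]
  have e : T ∩ v ⁻¹' {d} = f '' (S ∩ {a | c + w a = d}) := by
    rw [← hf.image_eq]
    ext b
    constructor
    · rintro ⟨⟨a, ha, rfl⟩, hb⟩
      exact ⟨a, ⟨ha, (hw a ha).symm.trans hb⟩, rfl⟩
    · rintro ⟨a, ⟨ha, hb⟩, rfl⟩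
      exact ⟨⟨a, ha, rfl⟩, by rw [← hb, Set.mem_preimage, hw a ha]; rfl⟩
  rw [e, (hf.injOn.mono Set.inter_subset_left).ncard_image, one_mul]
  split_ifs with hc
  · rw [coeff_weightGF]
    congr 3
    ext a
    constructor
    · rintro rfl; simp
    · intro h
      rw [Set.mem_preimage, Set.mem_singleton_iff] at h
      rw [Set.mem_ofPred_eq, h, add_tsub_cancel_of_le hc]
  · have : S ∩ {a | c + w a = d} = ∅ := by
      ext a
      simp only [Set.mem_inter_iff, Set.mem_ofPred_eq, Set.mem_empty_iff_false, iff_false, not_and]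
      rintro _ rfl
      exact hc le_self_add
    simp [this]

/-! ### Avoiding words and their decomposition at the first letter -/

/-- No entry followed by a smaller one is followed, later still, by a larger one. -/
def Avoids102 : List ℕ → Prop
  | [] => True
  | a :: l => l.Pairwise (fun u v => u < a → v ≤ a) ∧ Avoids102 l

theorem Avoids102.right : ∀ {P Q : List ℕ}, Avoids102 (P ++ Q) → Avoids102 Q
  | [], _, h => h
  | _ :: P, _, h => Avoids102.right (P := P) h.2

theorem Avoids102.left : ∀ {P Q : List ℕ}, Avoids102 (P ++ Q) → Avoids102 P
  | [], _, _ => trivial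
  | _ :: P, _, h => ⟨(List.pairwise_append.1 h.1).1, Avoids102.left (P := P) h.2⟩

/-- A 102 starting in `P` and ending in `Q` would need a last letter above its first, but the last
is at most `a` and the first at least `a`. -/
theorem avoids102_append {a : ℕ} {Q : List ℕ} (hQ : Avoids102 Q) (hQa : ∀ q ∈ Q, q ≤ a) :
    ∀ {P : List ℕ}, (∀ p ∈ P, a ≤ p) → Avoids102 P → Avoids102 (P ++ Q)
  | [], _, _ => hQ
  | p :: P, hP, h => by
    have hp : a ≤ p := hP p (by simp)
    refine ⟨List.pairwise_append.2 ⟨h.1, ?_, ?_⟩,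
      avoids102_append hQ hQa (fun q hq => hP q (by simp [hq])) h.2⟩
    · exact List.pairwise_of_forall_mem_list fun u _ v hv _ => (hQa v hv).trans hp
    · exact fun u _ v hv _ => (hQa v hv).trans hp

/-- If `Q` is nonempty, `a` and the head of `Q` play the roles of 1 and 0, so no later letter may
exceed `a`. -/
theorem avoids102_cons_append {a : ℕ} {P Q : List ℕ} (hP : ∀ p ∈ P, a ≤ p)
    (hQ : ∀ b ∈ Q.head?, b < a) :
    Avoids102 (a :: (P ++ Q)) ↔ Avoids102 P ∧ Avoids102 Q ∧ ∀ q ∈ Q, q ≤ a := by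
  constructor
  · rintro ⟨h1, h2⟩
    refine ⟨h2.left, h2.right, ?_⟩
    have h3 := (List.pairwise_append.1 h1).2.1
    cases Q with
    | nil => simp
    | cons b Q =>
      have hb : b < a := hQ b rfl
      intro q hq
      rcases List.mem_cons.1 hq with rfl | hq
      · exact hb.le
      · exact (List.pairwise_cons.1 h3).1 q hq hb
  · rintro ⟨h1, h2, h3⟩
    refine ⟨List.pairwise_append.2 ⟨?_, ?_, ?_⟩, avoids102_append h2 h3 hP h1⟩
    · exact List.pairwise_of_forall_mem_list fun u hu v _ h => absurd (hP u hu) (not_le.2 h)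
    · exact List.pairwise_of_forall_mem_list fun u _ v hv _ => h3 v hv
    · exact fun u _ v hv _ => h3 v hv

/-- Words avoiding `102` and `000` with letters at least `lo`, with `lo` used exactly `i` times, and
with the property `τ`. -/
def wordClass (lo i : ℕ) (τ : List ℕ → Prop) : Set (List ℕ) :=
  {l | Avoids102 l ∧ (∀ v ∈ l, lo ≤ v) ∧ l.count lo = i ∧ (∀ v, l.count v ≤ 2) ∧ τ l}

/-- All letters are at most `hi`, and `hi` occurs exactly `j` times. -/
def HasRoof (hi j : ℕ) (l : List ℕ) : Prop :=
  (∀ v ∈ l, v ≤ hi) ∧ l.count hi = j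

/-- The letter in position `k`, counted from `0`, is at most `s + k`. -/
def HasSlack : ℕ → List ℕ → Prop
  | _, [] => True
  | s, a :: l => a ≤ s ∧ HasSlack (s + 1) l

/-- The words of `wordClass` whose largest possible letter `hi` is used exactly `j` times. -/
def boxClass (lo hi i j : ℕ) : Set (List ℕ) := wordClass lo i (HasRoof hi j)

/-- The words of `boxClass` that do not begin with `hi`. -/
def boxClass' (lo hi i j : ℕ) : Set (List ℕ) :=
  {l ∈ boxClass lo hi i j | hi ∉ l.head?}

/-- The length and the number of distinct letters of a word. -/
noncomputable def listWeight (l : List ℕ) : Fin 2 →₀ ℕ :=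
  Finsupp.single 0 l.length + Finsupp.single 1 l.toFinset.card

theorem finiteFibers_of_bound {S : Set (List ℕ)} (B : ℕ → ℕ)
    (h : ∀ l ∈ S, ∀ v ∈ l, v ≤ B l.length) : FiniteFibers listWeight S := by
  intro d
  have hf : (Set.range fun e : Fin (d 0) → Fin (B (d 0) + 1) =>
      List.ofFn fun i => (e i : ℕ)).Finite := Set.finite_range _
  refine hf.subset ?_
  rintro l ⟨hl, hd⟩
  have hlen : l.length = d 0 := by
    have := DFunLike.congr_fun (show listWeight l = d from hd) 0
    simpa [listWeight] using this
  have hB := h l hl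
  rw [hlen] at hB
  clear hd
  generalize d 0 = n at *
  subst hlen
  refine ⟨fun i => ⟨l.get i, Nat.lt_succ_of_le (hB _ (List.get_mem _ _))⟩, ?_⟩
  simp

theorem HasSlack.le : ∀ {s : ℕ} {l : List ℕ}, HasSlack s l → ∀ v ∈ l, v ≤ s + l.length
  | _, [], _ => by simp
  | s, a :: l, h => by
    intro v hv
    rcases List.mem_cons.1 hv with rfl | hv
    · exact h.1.trans (Nat.le_add_right _ _)
    · have := h.2.le v hv
      rw [List.length_cons]; omega

/-- The bound only grows along the word, so letters at most `a ≤ s` meet it automatically. -/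
theorem hasSlack_append_iff {a : ℕ} {Q : List ℕ} (hQ : ∀ q ∈ Q, q ≤ a) :
    ∀ {s : ℕ} {P : List ℕ}, a ≤ s → (HasSlack s (P ++ Q) ↔ HasSlack s P)
  | s, [], h => by
    suffices ∀ (Q : List ℕ) s, a ≤ s → (∀ q ∈ Q, q ≤ a) → HasSlack s Q by
      simpa [HasSlack] using this Q s h hQ
    intro Q
    induction Q with
    | nil => intro s _ _; trivial
    | cons b Q ih =>
      intro s hs hb
      exact ⟨(hb b (by simp)).trans hs, ih _ (by omega) fun q hq => hb q (by simp [hq])⟩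
  | s, p :: P, h => by
    rw [List.cons_append, HasSlack, HasSlack, hasSlack_append_iff hQ (by omega)]

theorem finiteFibers_boxClass (lo hi i j : ℕ) : FiniteFibers listWeight (boxClass lo hi i j) :=
  finiteFibers_of_bound (fun _ => hi) fun _ hl => hl.2.2.2.2.1

theorem finiteFibers_slackClass (lo s i : ℕ) :
    FiniteFibers listWeight (wordClass lo i (HasSlack s)) :=
  finiteFibers_of_bound (fun n => s + n) fun _ hl => hl.2.2.2.2.le

/-- The heart of the decomposition. The leading `a` uses one of its two permitted occurrences,
whence `k + l ≤ 1`. Letters below `a`, including all copies of `lo`, lie in `Q`, and letters above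
`a` lie in `P`, so the multiplicity conditions separate. The property `τ'` is what `τ` demands of
`P`. -/
theorem mem_wordClass_cons_append {lo a i : ℕ} (hlo : lo < a) {τ τ' : List ℕ → Prop}
    {P Q : List ℕ} (hP : ∀ p ∈ P, a ≤ p) (hQ : ∀ b ∈ Q.head?, b < a)
    (hτ : (∀ q ∈ Q, q ≤ a) → (τ (a :: (P ++ Q)) ↔ τ' P)) :
    a :: (P ++ Q) ∈ wordClass lo i τ ↔
      ∃ k l, k + l ≤ 1 ∧ P ∈ wordClass a k τ' ∧ Q ∈ boxClass' lo a i l := by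
  have hhead : a ∉ Q.head? := fun h => lt_irrefl _ (hQ a h)
  have hPlo : ∀ v, v < a → P.count v = 0 := fun v hv =>
    List.count_eq_zero.2 fun h => absurd (hP v h) (not_le.2 hv)
  constructor
  · rintro ⟨h1, h2, h3, h4, h5⟩
    obtain ⟨hP1, hQ1, hQa⟩ := (avoids102_cons_append hP hQ).1 h1
    simp only [List.count_cons, List.count_append] at h3 h4
    refine ⟨P.count a, Q.count a, ?_, ⟨hP1, hP, rfl, fun v => ?_, (hτ hQa).1 h5⟩,
      ⟨⟨hQ1, fun v hv => h2 v (by simp [hv]), ?_, fun v => ?_, hQa, rfl⟩, hhead⟩⟩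
    · have := h4 a
      simp at this; omega
    · have := h4 v; omega
    · rw [hPlo lo hlo, if_neg (by simp; omega)] at h3
      omega
    · have := h4 v; omega
  · rintro ⟨k, l, hkl, ⟨hP1, -, rfl, hP3, hP4⟩, ⟨⟨hQ1, hQ2, rfl, hQ4, hQa, rfl⟩, -⟩⟩
    refine ⟨(avoids102_cons_append hP hQ).2 ⟨hP1, hQ1, hQa⟩, ?_, ?_, fun v => ?_, (hτ hQa).2 hP4⟩
    · intro v hv
      simp only [List.mem_cons, List.mem_append] at hv
      rcases hv with rfl | hv | hv
      · exact hlo.le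
      · exact hlo.le.trans (hP v hv)
      · exact hQ2 v hv
    · rw [List.count_cons, List.count_append, hPlo lo hlo, if_neg (by simp; omega)]
      omega
    · rw [List.count_cons, List.count_append]
      rcases lt_trichotomy v a with hv | rfl | hv
      · have := hQ4 v
        rw [hPlo v hv, if_neg (by simp; omega)]; omega
      · simp; omega
      · have := hP3 v
        have hQv : Q.count v = 0 := List.count_eq_zero.2 fun h => absurd (hQa v h) (not_le.2 hv)
        rw [hQv, if_neg (by simp; omega)]; omega

theorem split_unique {a : ℕ} {P Q : List ℕ} (hP : ∀ p ∈ P, a ≤ p) (hQ : ∀ b ∈ Q.head?, b < a) :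
    (P ++ Q).takeWhile (a ≤ ·) = P ∧ (P ++ Q).dropWhile (a ≤ ·) = Q := by
  rw [List.takeWhile_append_of_pos (by simpa using hP),
    List.dropWhile_append_of_pos (by simpa using hP)]
  cases Q with
  | nil => simp
  | cons b Q =>
    have : b < a := hQ b rfl
    simp [this]

theorem dropWhile_head_lt (a : ℕ) (l : List ℕ) :
    ∀ b ∈ (l.dropWhile (a ≤ ·)).head?, b < a := by
  induction l with
  | nil => simp
  | cons c l ih =>
    by_cases h : a ≤ c
    · rw [List.dropWhile_cons_of_pos (by simpa using h)]; exact ih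
    · rw [List.dropWhile_cons_of_neg (by simpa using h)]
      intro b hb
      simp at hb; omega

theorem head_lt_of_mem_boxClass' {lo a i l : ℕ} {Q : List ℕ} (h : Q ∈ boxClass' lo a i l) :
    ∀ b ∈ Q.head?, b < a := by
  intro b hb
  refine lt_of_le_of_ne (h.1.2.2.2.2.1 b (List.mem_of_mem_head? hb)) ?_
  rintro rfl
  exact h.2 hb

/-- `P` and `Q` could share only the letter `a`, which `k + l ≤ 1` excludes. The leading `a` adds a
new distinct letter exactly when it does not recur. -/
theorem listWeight_cons_append {lo a i k l : ℕ} {τ : List ℕ → Prop} {P Q : List ℕ}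
    (hkl : k + l ≤ 1) (hP : P ∈ wordClass a k τ) (hQ : Q ∈ boxClass' lo a i l) :
    listWeight (a :: (P ++ Q)) =
      (Finsupp.single 0 1 + Finsupp.single 1 (if k + l = 0 then 1 else 0)) +
        (listWeight P + listWeight Q) := by
  obtain ⟨-, hP1, rfl, -, -⟩ := hP
  obtain ⟨⟨-, -, -, -, hQ1, rfl⟩, -⟩ := hQ
  have hd : Disjoint P.toFinset Q.toFinset := by
    rw [Finset.disjoint_left]
    intro v hv hv'
    rw [List.mem_toFinset] at hv hv'
    obtain rfl := le_antisymm (hQ1 v hv') (hP1 v hv)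
    have h1 := List.count_pos_iff.2 hv
    have h2 := List.count_pos_iff.2 hv'
    omega
  have hcard : (a :: (P ++ Q)).toFinset.card =
      (if P.count a + Q.count a = 0 then 1 else 0) + (P.toFinset.card + Q.toFinset.card) := by
    rw [List.toFinset_cons, List.toFinset_append, ← Finset.card_union_of_disjoint hd]
    split_ifs with h0
    · rw [Finset.card_insert_of_notMem, add_comm]
      rw [Finset.mem_union, List.mem_toFinset, List.mem_toFinset, ← List.count_pos_iff,
        ← List.count_pos_iff]
      omega
    · rw [Finset.insert_eq_of_mem, zero_add]
      rw [Finset.mem_union, List.mem_toFinset, List.mem_toFinset, ← List.count_pos_iff,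
        ← List.count_pos_iff]
      omega
  unfold listWeight
  rw [hcard]
  simp only [List.length_cons, List.length_append, Finsupp.single_add]
  abel

theorem weightGF_eq_head_sum {S : Set (List ℕ)} (hS : FiniteFibers listWeight S) {s : Finset ℕ}
    (h : ∀ l ∈ S, ∀ a ∈ l.head?, a ∈ s) :
    weightGF listWeight S = weightGF listWeight (S ∩ {[]}) +
      ∑ a ∈ s, weightGF listWeight {l ∈ S | a ∈ l.head?} := by
  obtain ⟨h1, h2⟩ := weightGF_biUnion s (fun a => {l ∈ S | a ∈ l.head?})
    (fun a _ => hS.mono (Set.sep_subset _ _))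
    (fun a _ b _ hab => by
      rw [Set.disjoint_left]
      rintro l ⟨-, hl⟩ ⟨-, hl'⟩
      exact hab (Option.mem_unique hl hl'))
  rw [← h2, ← weightGF_union (hS.mono Set.inter_subset_left) h1]
  · congr 1
    ext l
    constructor
    · intro hl
      cases l with
      | nil => exact Or.inl ⟨hl, rfl⟩
      | cons a l => exact Or.inr (Set.mem_biUnion (h _ hl a rfl) ⟨hl, rfl⟩)
    · rintro (hl | hl)
      · exact hl.1
      · simp only [Set.mem_iUnion] at hl
        obtain ⟨a, -, hl⟩ := hl
        exact hl.1
  · rw [Set.disjoint_left]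
    rintro l ⟨-, rfl⟩ hl
    simp at hl

theorem monomial_one_one : (MvPowerSeries.monomial (Finsupp.single 0 1 + Finsupp.single 1 1) 1 :
    MvPowerSeries (Fin 2) ℚ) = MvPowerSeries.X 0 * MvPowerSeries.X 1 := by
  rw [MvPowerSeries.X, MvPowerSeries.X, MvPowerSeries.monomial_mul_monomial, one_mul]

theorem listWeight_cons_of_notMem {a : ℕ} {l : List ℕ} (h : a ∉ l) :
    listWeight (a :: l) = (Finsupp.single 0 1 + Finsupp.single 1 1) + listWeight l := by
  unfold listWeight
  rw [List.toFinset_cons, Finset.card_insert_of_notMem (by simpa using h), List.length_cons,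
    Finsupp.single_add, Finsupp.single_add]
  abel

/-- A leading smallest letter has nothing below it, so it starts no 102 and can be removed freely.
In `weightGF_head_hi` a leading largest letter has nothing above it. -/
theorem weightGF_head_lo {lo : ℕ} {τ τ' : List ℕ → Prop} (hτ : ∀ l, τ (lo :: l) ↔ τ' l) :
    weightGF listWeight {l ∈ wordClass lo 1 τ | lo ∈ l.head?} =
      MvPowerSeries.X 0 * MvPowerSeries.X 1 * weightGF listWeight (wordClass lo 0 τ') := by
  rw [← monomial_one_one]
  refine weightGF_bijOn (f := List.cons lo) _ ⟨?_, List.cons_injective.injOn, ?_⟩ ?_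
  · rintro l ⟨h1, h2, h3, h4, h5⟩
    refine ⟨⟨⟨?_, h1⟩, ?_, by simp [h3], fun v => ?_, (hτ l).2 h5⟩, rfl⟩
    · exact List.pairwise_of_forall_mem_list fun u hu v _ h => absurd (h2 u hu) (not_le.2 h)
    · intro v hv
      rcases List.mem_cons.1 hv with rfl | hv
      · exact le_rfl
      · exact h2 v hv
    · rw [List.count_cons]
      have := h4 v
      split_ifs with h
      · obtain rfl : lo = v := by simpa using h
        omega
      · omega
  · rintro l ⟨⟨h1, h2, h3, h4, h5⟩, hl⟩
    cases l with
    | nil => simp at hl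
    | cons b l =>
      obtain rfl : b = lo := by simpa using hl
      refine ⟨l, ⟨h1.2, fun v hv => h2 v (by simp [hv]), by simpa using h3, fun v => ?_,
        (hτ l).1 h5⟩, rfl⟩
      exact (List.count_le_count_cons).trans (h4 v)
  · rintro l ⟨-, -, h3, -⟩
    exact listWeight_cons_of_notMem (List.count_eq_zero.1 h3)

theorem weightGF_head_hi {lo hi i : ℕ} (h : lo < hi) :
    weightGF listWeight {l ∈ boxClass lo hi i 1 | hi ∈ l.head?} =
      MvPowerSeries.X 0 * MvPowerSeries.X 1 * weightGF listWeight (boxClass lo hi i 0) := by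
  rw [← monomial_one_one]
  refine weightGF_bijOn (f := List.cons hi) _ ⟨?_, List.cons_injective.injOn, ?_⟩ ?_
  · rintro l ⟨h1, h2, h3, h4, h5, h6⟩
    refine ⟨⟨⟨?_, h1⟩, ?_, ?_, fun v => ?_, ?_, by simp [h6]⟩, rfl⟩
    · exact List.pairwise_of_forall_mem_list fun u _ v hv _ => h5 v hv
    · intro v hv
      rcases List.mem_cons.1 hv with rfl | hv
      · exact h.le
      · exact h2 v hv
    · rw [List.count_cons, h3, if_neg (by simp; omega)]; rfl
    · rw [List.count_cons]
      have := h4 v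
      split_ifs with h
      · obtain rfl : hi = v := by simpa using h
        omega
      · omega
    · intro v hv
      rcases List.mem_cons.1 hv with rfl | hv
      · exact le_rfl
      · exact h5 v hv
  · rintro l ⟨⟨h1, h2, h3, h4, h5, h6⟩, hl⟩
    cases l with
    | nil => simp at hl
    | cons b l =>
      obtain rfl : b = hi := by simpa using hl
      refine ⟨l, ⟨h1.2, fun v hv => h2 v (by simp [hv]), ?_, fun v => ?_,
        fun v hv => h5 v (by simp [hv]), by simpa using h6⟩, rfl⟩
      · rwa [List.count_cons, if_neg (by simp; omega)] at h3
      · exact (List.count_le_count_cons).trans (h4 v)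
  · rintro l ⟨-, -, -, -, -, h6⟩
    exact listWeight_cons_of_notMem (List.count_eq_zero.1 h6)

theorem boxClass'_zero (lo hi i : ℕ) : boxClass' lo hi i 0 = boxClass lo hi i 0 := by
  refine Set.sep_eq_self_iff_mem_true.2 fun l hl h => ?_
  exact List.count_eq_zero.1 hl.2.2.2.2.2 (List.mem_of_mem_head? h)

theorem weightGF_boxClass'_one {lo hi i : ℕ} (h : lo < hi) :
    weightGF listWeight (boxClass' lo hi i 1) = weightGF listWeight (boxClass lo hi i 1) -
      MvPowerSeries.X 0 * MvPowerSeries.X 1 * weightGF listWeight (boxClass lo hi i 0) := by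
  have hf := finiteFibers_boxClass lo hi i 1
  rw [← weightGF_head_hi h, eq_sub_iff_add_eq, boxClass', ← weightGF_union
    (hf.mono (Set.sep_subset _ _)) (hf.mono (Set.sep_subset _ _))]
  · congr 1
    ext l
    by_cases hl : l.head? = some hi <;> simp [hl]
  · rw [Set.disjoint_left]
    exact fun l h1 h2 => h1.2 h2.2

/-- The words whose first letter is `a`, split into the letters before and after the first descent
below `a`, when `a` occurs `k` more times before and `l` more times after. -/
def splitClass (lo a i k l : ℕ) (τ : List ℕ → Prop) : Set (List ℕ) :=
  (fun p : List ℕ × List ℕ => a :: (p.1 ++ p.2)) '' (wordClass a k τ ×ˢ boxClass' lo a i l)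

theorem weightGF_splitClass {lo a i k l : ℕ} {τ : List ℕ → Prop} (hkl : k + l ≤ 1)
    (hf : FiniteFibers listWeight (wordClass a k τ)) :
    weightGF listWeight (splitClass lo a i k l τ) =
      MvPowerSeries.monomial
        (Finsupp.single 0 1 + Finsupp.single 1 (if k + l = 0 then 1 else 0)) 1 *
        (weightGF listWeight (wordClass a k τ) * weightGF listWeight (boxClass' lo a i l)) := by
  have hf' : FiniteFibers listWeight (boxClass' lo a i l) :=
    (finiteFibers_boxClass lo a i l).mono (Set.sep_subset _ _)
  rw [← weightGF_prod hf hf']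
  refine weightGF_bijOn _ (Set.InjOn.bijOn_image ?_) ?_
  · rintro ⟨P, Q⟩ ⟨hP, hQ⟩ ⟨P', Q'⟩ ⟨hP', hQ'⟩ h
    have h1 := split_unique hP.2.1 (head_lt_of_mem_boxClass' hQ)
    have h2 := split_unique hP'.2.1 (head_lt_of_mem_boxClass' hQ')
    rw [(List.cons.inj h).2] at h1
    exact Prod.ext (h1.1.symm.trans h2.1) (h1.2.symm.trans h2.2)
  · rintro ⟨P, Q⟩ ⟨hP, hQ⟩
    exact listWeight_cons_append hkl hP hQ

theorem disjoint_splitClass {lo a i k l k' l' : ℕ} {τ : List ℕ → Prop} (h : k ≠ k' ∨ l ≠ l') :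
    Disjoint (splitClass lo a i k l τ) (splitClass lo a i k' l' τ) := by
  rw [Set.disjoint_left]
  rintro _ ⟨⟨P, Q⟩, ⟨hP, hQ⟩, rfl⟩ ⟨⟨P', Q'⟩, ⟨hP', hQ'⟩, e⟩
  have h1 := split_unique hP.2.1 (head_lt_of_mem_boxClass' hQ)
  have h2 := split_unique hP'.2.1 (head_lt_of_mem_boxClass' hQ')
  rw [(List.cons.inj e).2] at h2
  obtain rfl : P = P' := h1.1.symm.trans h2.1
  obtain rfl : Q = Q' := h1.2.symm.trans h2.2
  have e1 : k = k' := hP.2.2.1.symm.trans hP'.2.2.1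
  have e2 : l = l' := hQ.1.2.2.2.2.2.symm.trans hQ'.1.2.2.2.2.2
  omega

/-- The three terms correspond to `a` not recurring, recurring in `P`, and recurring in `Q`. In the
last, words `Q` that begin with `a` are subtracted, since that `a` would belong to `P`. Only a
non-recurring `a` brings in the factor y. -/
theorem weightGF_head {lo a i : ℕ} (hlo : lo < a) {τ τ' : List ℕ → Prop}
    (hfS : FiniteFibers listWeight (wordClass lo i τ))
    (hf : ∀ k, FiniteFibers listWeight (wordClass a k τ'))
    (hτ : ∀ P Q : List ℕ, (∀ q ∈ Q, q ≤ a) → (τ (a :: (P ++ Q)) ↔ τ' P)) :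
    weightGF listWeight {l ∈ wordClass lo i τ | a ∈ l.head?} =
      MvPowerSeries.X 0 * MvPowerSeries.X 1 * (weightGF listWeight (wordClass a 0 τ') *
        weightGF listWeight (boxClass lo a i 0)) +
      MvPowerSeries.X 0 * (weightGF listWeight (wordClass a 1 τ') *
        weightGF listWeight (boxClass lo a i 0)) +
      MvPowerSeries.X 0 * (weightGF listWeight (wordClass a 0 τ') *
        (weightGF listWeight (boxClass lo a i 1) - MvPowerSeries.X 0 * MvPowerSeries.X 1 *
          weightGF listWeight (boxClass lo a i 0))) := by
  have e : {l ∈ wordClass lo i τ | a ∈ l.head?} =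
      (splitClass lo a i 0 0 τ' ∪ splitClass lo a i 1 0 τ') ∪ splitClass lo a i 0 1 τ' := by
    ext l
    constructor
    · rintro ⟨hl, ha⟩
      cases l with
      | nil => simp at ha
      | cons b l =>
        obtain rfl : b = a := by simpa using ha
        rw [← List.takeWhile_append_dropWhile (p := (b ≤ ·)) (l := l)] at hl ⊢
        set P := l.takeWhile (b ≤ ·) with hP
        set Q := l.dropWhile (b ≤ ·) with hQ
        obtain ⟨k, j, hkj, h1, h2⟩ := (mem_wordClass_cons_append hlo (P := P) (Q := Q)
          (fun p hp => by simpa using List.mem_takeWhile_imp hp) (dropWhile_head_lt b l)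
          (hτ P Q)).1 hl
        have hmem : b :: (P ++ Q) ∈ splitClass lo b i k j τ' := ⟨(P, Q), ⟨h1, h2⟩, rfl⟩
        obtain ⟨rfl, rfl⟩ | ⟨rfl, rfl⟩ | ⟨rfl, rfl⟩ :
            (k = 0 ∧ j = 0) ∨ (k = 1 ∧ j = 0) ∨ (k = 0 ∧ j = 1) := by omega
        · exact Or.inl (Or.inl hmem)
        · exact Or.inl (Or.inr hmem)
        · exact Or.inr hmem
    · have key : ∀ k j, k + j ≤ 1 → l ∈ splitClass lo a i k j τ' →
          l ∈ {l ∈ wordClass lo i τ | a ∈ l.head?} := by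
        rintro k j hkj ⟨⟨P, Q⟩, ⟨hP, hQ⟩, rfl⟩
        exact ⟨(mem_wordClass_cons_append hlo hP.2.1 (head_lt_of_mem_boxClass' hQ) (hτ P Q)).2
          ⟨k, j, hkj, hP, hQ⟩, rfl⟩
      rintro ((h | h) | h)
      exacts [key 0 0 (by omega) h, key 1 0 (by omega) h, key 0 1 (by omega) h]
  have hfU := hfS.mono (Set.sep_subset _ (fun l => a ∈ l.head?))
  rw [e] at hfU ⊢
  rw [weightGF_union (hfU.mono Set.subset_union_left) (hfU.mono Set.subset_union_right),
    weightGF_union (hfU.mono (Set.subset_union_left.trans Set.subset_union_left))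
      (hfU.mono (Set.subset_union_right.trans Set.subset_union_left)),
    weightGF_splitClass (by omega) (hf _), weightGF_splitClass (by omega) (hf _),
    weightGF_splitClass (by omega) (hf _), boxClass'_zero, weightGF_boxClass'_one hlo]
  · simp only [add_zero, if_true, zero_add, one_ne_zero, if_false, monomial_one_one,
      Finsupp.single_zero]
    rfl
  · exact disjoint_splitClass (Or.inl (by omega))
  · exact Disjoint.union_left (disjoint_splitClass (Or.inr (by omega)))
      (disjoint_splitClass (Or.inr (by omega)))

/-! ### Translation of the alphabet -/

theorem avoids102_map_add (k : ℕ) : ∀ l : List ℕ, Avoids102 (l.map (k + ·)) ↔ Avoids102 l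
  | [] => Iff.rfl
  | a :: l => by
    rw [List.map_cons, Avoids102, Avoids102, List.pairwise_map, avoids102_map_add k l]
    simp

theorem hasSlack_map_add (k : ℕ) : ∀ (s : ℕ) (l : List ℕ),
    HasSlack (k + s) (l.map (k + ·)) ↔ HasSlack s l
  | _, [] => Iff.rfl
  | s, a :: l => by
    rw [List.map_cons, HasSlack, HasSlack, add_assoc, hasSlack_map_add k (s + 1) l]
    simp

theorem hasRoof_map_add (k hi j : ℕ) (l : List ℕ) :
    HasRoof (k + hi) j (l.map (k + ·)) ↔ HasRoof hi j l := by
  rw [HasRoof, HasRoof, List.count_map_of_injective _ _ (add_right_injective k)]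
  simp

theorem listWeight_map_add (k : ℕ) (l : List ℕ) :
    listWeight (l.map (k + ·)) = listWeight l := by
  have : (l.map (k + ·)).toFinset = l.toFinset.image (k + ·) := by
    ext; simp
  rw [listWeight, this, Finset.card_image_of_injective _ (add_right_injective k), List.length_map]
  rfl

theorem weightGF_wordClass_add {τ τ' : List ℕ → Prop} (k lo i : ℕ)
    (hτ : ∀ l, τ' (l.map (k + ·)) ↔ τ l) :
    weightGF listWeight (wordClass (k + lo) i τ') = weightGF listWeight (wordClass lo i τ) := by
  have hinj := add_right_injective k
  have hb : Set.BijOn (List.map (k + ·)) (wordClass lo i τ) (wordClass (k + lo) i τ') := by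
    have key : ∀ l : List ℕ, l.map (k + ·) ∈ wordClass (k + lo) i τ' ↔ l ∈ wordClass lo i τ := by
      intro l
      rw [wordClass, wordClass, Set.mem_ofPred_eq, Set.mem_ofPred_eq, avoids102_map_add,
        List.count_map_of_injective _ _ hinj, hτ]
      have : (∀ v, (l.map (k + ·)).count v ≤ 2) ↔ ∀ v, l.count v ≤ 2 := by
        constructor
        · intro h v
          rw [← List.count_map_of_injective l _ hinj]
          exact h _
        · intro h v
          by_cases hv : v ∈ l.map (k + ·)
          · obtain ⟨u, -, rfl⟩ := List.mem_map.1 hv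
            rw [List.count_map_of_injective _ _ hinj]
            exact h u
          · rw [List.count_eq_zero.2 hv]; omega
      rw [this]
      simp
    refine ⟨fun l hl => (key l).2 hl, (List.map_injective_iff.2 hinj).injOn, fun l hl => ?_⟩
    have e : (l.map (· - k)).map (k + ·) = l := by
      rw [List.map_map]
      conv_rhs => rw [← List.map_id l]
      refine List.map_congr_left fun v hv => ?_
      have := hl.2.1 v hv
      simp; omega
    exact ⟨l.map (· - k), (key _).1 (by rwa [e]), e⟩
  rw [weightGF_bijOn (w := listWeight) 0 hb fun l _ => by rw [listWeight_map_add, zero_add],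
    MvPowerSeries.monomial_zero_one, one_mul]

/-- The generating function of the words with `N` ordinary letters, and in addition with a smallest
letter used exactly `i` times and a largest letter used exactly `j` times. -/
noncomputable def boxGF (i j N : ℕ) : MvPowerSeries (Fin 2) ℚ :=
  weightGF listWeight (boxClass 0 (N + 1) i j)

/-- The generating function of the words with positive letters whose letter in position `k` is at
most `N + k`, and in addition with a smallest letter `0` used exactly `i` times. -/
noncomputable def slackGF (i N : ℕ) : MvPowerSeries (Fin 2) ℚ :=
  weightGF listWeight (wordClass 0 i (HasSlack N))

theorem weightGF_boxClass_add (k N i j : ℕ) :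
    weightGF listWeight (boxClass k (k + (N + 1)) i j) = boxGF i j N :=
  weightGF_wordClass_add k 0 i fun l => hasRoof_map_add k (N + 1) j l

theorem weightGF_slack_add (k N i : ℕ) :
    weightGF listWeight (wordClass k i (HasSlack (k + N))) = slackGF i N :=
  weightGF_wordClass_add k 0 i fun l => hasSlack_map_add k N l

theorem weightGF_inter_nil {S : Set (List ℕ)} {p : Prop} [Decidable p] (h : [] ∈ S ↔ p) :
    weightGF listWeight (S ∩ {[]}) = if p then 1 else 0 := by
  split_ifs with hp
  · rw [Set.inter_eq_right.2 (by simpa using h.2 hp), weightGF_singleton]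
    simp [listWeight]
  · have : S ∩ {[]} = ∅ := by
      ext l
      simp only [Set.mem_inter_iff, Set.mem_singleton_iff, Set.mem_empty_iff_false, iff_false,
        not_and]
      rintro hl rfl
      exact hp (h.1 hl)
    rw [this, weightGF_empty]

theorem weightGF_head_zero {lo : ℕ} {τ : List ℕ → Prop} :
    weightGF listWeight {l ∈ wordClass lo 0 τ | lo ∈ l.head?} = 0 := by
  have : {l ∈ wordClass lo 0 τ | lo ∈ l.head?} = ∅ := by
    ext l
    simp only [Set.mem_ofPred_eq, Set.mem_empty_iff_false, iff_false, not_and]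
    intro hl h
    exact List.count_eq_zero.1 hl.2.2.1 (List.mem_of_mem_head? h)
  rw [this, weightGF_empty]

theorem weightGF_head_zero_hi {lo hi i : ℕ} :
    weightGF listWeight {l ∈ boxClass lo hi i 0 | hi ∈ l.head?} = 0 := by
  have : {l ∈ boxClass lo hi i 0 | hi ∈ l.head?} = ∅ := by
    ext l
    simp only [Set.mem_ofPred_eq, Set.mem_empty_iff_false, iff_false, not_and]
    intro hl h
    exact List.count_eq_zero.1 hl.2.2.2.2.2 (List.mem_of_mem_head? h)
  rw [this, weightGF_empty]

/-! ### Recursions for the box and slack generating functions -/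

open MvPowerSeries in
theorem boxGF_rec (N : ℕ) {i j : ℕ} (hi : i ≤ 1) (hj : j ≤ 1) :
    boxGF i j N = (if i = 0 ∧ j = 0 then 1 else 0) +
      ((if i = 1 then X 0 * X 1 * boxGF 0 j N else 0) +
      ((if j = 1 then X 0 * X 1 * boxGF i 0 N else 0) +
      ∑ k ∈ Finset.range N,
        (X 0 * X 1 * (boxGF 0 j (N - 1 - k) * boxGF i 0 k) +
          X 0 * (boxGF 1 j (N - 1 - k) * boxGF i 0 k) +
          X 0 * (boxGF 0 j (N - 1 - k) * (boxGF i 1 k - X 0 * X 1 * boxGF i 0 k))))) := by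
  rw [boxGF, weightGF_eq_head_sum (finiteFibers_boxClass _ _ _ _) (s := Finset.range (N + 1 + 1))
    fun l hl a ha => Finset.mem_range.2
      (Nat.lt_succ_of_le (hl.2.2.2.2.1 a (List.mem_of_mem_head? ha))),
    Finset.sum_range_succ, Finset.sum_range_succ', weightGF_inter_nil (p := i = 0 ∧ j = 0)]
  · congr 1
    rw [add_comm (Finset.sum _ _), add_assoc]
    congr 1
    · obtain rfl | rfl : i = 0 ∨ i = 1 := by omega
      · rw [if_neg (by omega)]; exact weightGF_head_zero
      · rw [if_pos rfl]
        exact weightGF_head_lo fun l => by simp [HasRoof]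
    rw [add_comm]
    congr 1
    · obtain rfl | rfl : j = 0 ∨ j = 1 := by omega
      · rw [if_neg (by omega)]; exact weightGF_head_zero_hi
      · rw [if_pos rfl]
        exact weightGF_head_hi (Nat.succ_pos N)
    · refine Finset.sum_congr rfl fun k hk => ?_
      have hk := Finset.mem_range.1 hk
      -- With first letter `k + 1`, the word `P` has bottom `k + 1`, top `N + 1`, and the `N - 1 -
      -- k` ordinary letters strictly between.
      have e : N + 1 = (k + 1) + ((N - 1 - k) + 1) := by omega
      refine (weightGF_head (Nat.succ_pos k) (τ' := HasRoof (N + 1) j)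
        (finiteFibers_boxClass 0 (N + 1) i j) (fun m => finiteFibers_boxClass _ _ _ _) ?_).trans ?_
      · intro P Q hQ
        have hQc : Q.count (N + 1) = 0 := List.count_eq_zero.2 fun h => by
          have := hQ _ h; omega
        have hne : k + 1 ≠ N + 1 := by omega
        rw [HasRoof, HasRoof, List.count_cons_of_ne hne, List.count_append, hQc, add_zero]
        refine and_congr_left fun _ => ⟨fun h v hv => h v (by simp [hv]), fun h v hv => ?_⟩
        simp only [List.mem_cons, List.mem_append] at hv
        rcases hv with rfl | hv | hv
        · omega
        · exact h v hv
        · have := hQ v hv; omega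
      · have e1 : ∀ m, weightGF listWeight (wordClass (k + 1) m (HasRoof (N + 1) j)) =
            boxGF m j (N - 1 - k) := by
          intro m
          rw [← weightGF_boxClass_add (k + 1), ← e]
          rfl
        rw [e1, e1]
        rfl
  · simp [boxClass, wordClass, HasRoof, Avoids102, eq_comm]

open MvPowerSeries in
theorem slackGF_rec (N : ℕ) {i : ℕ} (hi : i ≤ 1) :
    slackGF i N = (if i = 0 then 1 else 0) +
      ((if i = 1 then X 0 * X 1 * slackGF 0 (N + 1) else 0) +
      ∑ k ∈ Finset.range N,
        (X 0 * X 1 * (slackGF 0 (N - 1 - k + 1) * boxGF i 0 k) +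
          X 0 * (slackGF 1 (N - 1 - k + 1) * boxGF i 0 k) +
          X 0 * (slackGF 0 (N - 1 - k + 1) * (boxGF i 1 k - X 0 * X 1 * boxGF i 0 k)))) := by
  rw [slackGF, weightGF_eq_head_sum (finiteFibers_slackClass _ _ _) (s := Finset.range (N + 1))
    (fun l hl a ha => ?_),
    Finset.sum_range_succ', weightGF_inter_nil (p := i = 0)]
  · congr 1
    rw [add_comm]
    congr 1
    · obtain rfl | rfl : i = 0 ∨ i = 1 := by omega
      · rw [if_neg (by omega)]; exact weightGF_head_zero
      · rw [if_pos rfl]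
        exact weightGF_head_lo fun l => by simp [HasSlack]
    · refine Finset.sum_congr rfl fun k hk => ?_
      have hk := Finset.mem_range.1 hk
      -- `P` starts one position later, so its bound starts at `N + 1`; measured from its bottom
      -- letter `k + 1`, the slack is `N - k`.
      have e : N + 1 = (k + 1) + (N - 1 - k + 1) := by omega
      refine (weightGF_head (Nat.succ_pos k) (τ' := HasSlack (N + 1))
        (finiteFibers_slackClass 0 N i) (fun m => finiteFibers_slackClass _ _ _) ?_).trans ?_
      · intro P Q hQ
        rw [HasSlack, hasSlack_append_iff hQ (by omega)]
        exact and_iff_right (by omega)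
      · have e1 : ∀ m, weightGF listWeight (wordClass (k + 1) m (HasSlack (N + 1))) =
            slackGF m (N - 1 - k + 1) := by
          intro m
          rw [← weightGF_slack_add (k + 1), ← e]
        rw [e1, e1]
        rfl
  · simp [wordClass, HasSlack, Avoids102, eq_comm]
  · cases l with
    | nil => simp at ha
    | cons b l =>
      obtain rfl : b = a := by simpa using ha
      exact Finset.mem_range.2 (Nat.lt_succ_of_le hl.2.2.2.2.1)

/-! ### Inversion sequences as words -/

theorem wordReduction_lt_iff {k : ℕ} (u : Fin k → ℕ) (i j : Fin k) :
    wordReduction u i < wordReduction u j ↔ u i < u j := by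
  have mono : ∀ i j, u i ≤ u j → wordReduction u i ≤ wordReduction u j := fun i j h =>
    Finset.card_le_card fun v hv => by
      rw [Finset.mem_filter] at hv ⊢
      exact ⟨hv.1, hv.2.trans_le h⟩
  refine ⟨fun h => not_le.1 fun h' => absurd (mono _ _ h') (not_le.2 h), fun h => ?_⟩
  refine Finset.card_lt_card ⟨fun v hv => ?_, fun hs => ?_⟩
  · rw [Finset.mem_filter] at hv ⊢
    exact ⟨hv.1, hv.2.trans h⟩
  · have := hs (Finset.mem_filter.2 ⟨Finset.mem_image_of_mem u (Finset.mem_univ i), h⟩)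
    exact lt_irrefl _ (Finset.mem_filter.1 this).2

theorem wordReduction_eq_102_iff (u : Fin 3 → ℕ) :
    wordReduction u = ![1, 0, 2] ↔ u 1 < u 0 ∧ u 0 < u 2 := by
  constructor
  · intro h
    have h1 := wordReduction_lt_iff u 1 0
    have h2 := wordReduction_lt_iff u 0 2
    rw [h] at h1 h2
    exact ⟨h1.1 (by simp), h2.1 (by simp)⟩
  · rintro ⟨h1, h2⟩
    have e : Finset.univ.image u = {u 0, u 1, u 2} := by
      ext v; simp [Fin.exists_fin_succ, eq_comm]
    funext j
    rw [wordReduction, e]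
    fin_cases j
    · have : ({u 0, u 1, u 2} : Finset ℕ).filter (· < u 0) = {u 1} := by
        ext v; simp; omega
      simp [this]
    · have : ({u 0, u 1, u 2} : Finset ℕ).filter (· < u 1) = ∅ := by
        ext v; simp; omega
      simp [this]
    · have : ({u 0, u 1, u 2} : Finset ℕ).filter (· < u 2) = {u 0, u 1} := by
        ext v; simp; omega
      simp only [Fin.reduceFinMk, this]
      rw [Finset.card_pair h1.ne']
      rfl

theorem wordReduction_eq_000_iff (u : Fin 3 → ℕ) :
    wordReduction u = ![0, 0, 0] ↔ u 0 = u 1 ∧ u 1 = u 2 := by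
  constructor
  · intro h
    have key : ∀ i j, ¬ u i < u j := by
      intro i j
      rw [← wordReduction_lt_iff, h]
      fin_cases i <;> fin_cases j <;> simp
    exact ⟨le_antisymm (not_lt.1 (key _ _)) (not_lt.1 (key _ _)),
      le_antisymm (not_lt.1 (key _ _)) (not_lt.1 (key _ _))⟩
  · rintro ⟨h1, h2⟩
    have hu : ∀ j, u j = u 2 := by
      intro j; fin_cases j <;> simp_all
    funext j
    have : wordReduction u j = 0 := by
      rw [wordReduction, Finset.card_eq_zero, Finset.filter_eq_empty_iff]
      intro v hv
      obtain ⟨i, -, rfl⟩ := Finset.mem_image.1 hv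
      rw [hu i, hu j]; exact lt_irrefl _
    rw [this]
    fin_cases j <;> rfl

theorem strictMono_vec_three {n : ℕ} {i j k : Fin n} (hij : i < j) (hjk : j < k) :
    StrictMono ![i, j, k] := by
  rw [Fin.strictMono_iff_lt_succ]
  intro m; fin_cases m
  · exact hij
  · exact hjk

theorem containsPattern_three_iff {n : ℕ} (e : Fin n → ℕ) (w : Fin 3 → ℕ) :
    ContainsPattern e w ↔
      ∃ i j k : Fin n, i < j ∧ j < k ∧ wordReduction ![e i, e j, e k] = w := by
  constructor
  · rintro ⟨f, hf, hw⟩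
    refine ⟨f 0, f 1, f 2, hf (by decide), hf (by decide), ?_⟩
    rw [← hw]
    congr 1
    funext m; fin_cases m <;> rfl
  · rintro ⟨i, j, k, hij, hjk, hw⟩
    refine ⟨![i, j, k], strictMono_vec_three hij hjk, ?_⟩
    rw [← hw]
    congr 1
    funext m; fin_cases m <;> rfl

theorem avoids102_ofFn : ∀ {n : ℕ} (e : Fin n → ℕ), Avoids102 (List.ofFn e) ↔
    ∀ i j k : Fin n, i < j → j < k → e j < e i → e k ≤ e i
  | 0, e => by simp [Avoids102]
  | n + 1, e => by
    rw [List.ofFn_succ, Avoids102, avoids102_ofFn, List.pairwise_ofFn]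
    constructor
    · rintro ⟨h1, h2⟩ i j k hij hjk
      obtain ⟨j, rfl⟩ := Fin.exists_succ_eq.2 (Fin.ne_zero_of_lt hij)
      obtain ⟨k, rfl⟩ := Fin.exists_succ_eq.2 (Fin.ne_zero_of_lt hjk)
      rw [Fin.succ_lt_succ_iff] at hjk
      cases i using Fin.cases with
      | zero => exact h1 hjk
      | succ i => exact h2 i j k (Fin.succ_lt_succ_iff.1 hij) hjk
    · intro h
      exact ⟨fun j k hjk => h 0 j.succ k.succ (Fin.succ_pos _) (Fin.succ_lt_succ_iff.2 hjk),
        fun i j k hij hjk => h _ _ _ (Fin.succ_lt_succ_iff.2 hij) (Fin.succ_lt_succ_iff.2 hjk)⟩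

theorem hasSlack_ofFn : ∀ {n : ℕ} (s : ℕ) (e : Fin n → ℕ), HasSlack s (List.ofFn e) ↔
    ∀ j : Fin n, e j ≤ s + j
  | 0, s, e => by simp [HasSlack]
  | n + 1, s, e => by
    rw [List.ofFn_succ, HasSlack, hasSlack_ofFn, Fin.forall_fin_succ]
    simp [add_assoc, add_comm 1]

/-- Three occurrences of `v` are the same as `List.replicate 3 v` being a sublist, and the embedding
of positions supplies the indices of the pattern. -/
theorem count_ofFn_le_two_iff {n : ℕ} (e : Fin n → ℕ) :
    (∀ v, (List.ofFn e).count v ≤ 2) ↔ ¬ ContainsPattern e ![0, 0, 0] := by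
  rw [containsPattern_three_iff, ← not_iff_not, not_not]
  push Not
  constructor
  · rintro ⟨v, hv⟩
    rw [← Nat.succ_le_iff, ← List.replicate_sublist_iff,
      List.sublist_iff_exists_fin_orderEmbedding_get_eq] at hv
    obtain ⟨f, hf⟩ := hv
    have h0 := hf ⟨0, by simp⟩
    have h1 := hf ⟨1, by simp⟩
    have h2 := hf ⟨2, by simp⟩
    simp only [List.get_eq_getElem, List.getElem_replicate, List.getElem_ofFn] at h0 h1 h2
    refine ⟨_, _, _, ?_, ?_, (wordReduction_eq_000_iff _).2 ⟨h0.symm.trans h1, h1.symm.trans h2⟩⟩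
    · exact f.strictMono (by simp)
    · exact f.strictMono (by simp [Fin.lt_def])
  · rintro ⟨i, j, k, hij, hjk, h⟩
    obtain ⟨h1, h2⟩ := (wordReduction_eq_000_iff _).1 h
    refine ⟨e i, ?_⟩
    rw [← Nat.succ_le_iff, ← List.replicate_sublist_iff,
      List.sublist_iff_exists_fin_orderEmbedding_get_eq]
    refine ⟨OrderEmbedding.ofStrictMono
      (fun m => (![i, j, k] (m.cast (by simp))).cast (by simp)) fun m m' hm => ?_, fun m => ?_⟩
    · exact strictMono_vec_three hij hjk hm
    · have hm : ∀ q, e i = e (![i, j, k] q) := by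
        intro q
        fin_cases q
        · rfl
        · exact h1
        · exact h1.trans h2
      rw [List.get_eq_getElem, List.getElem_replicate]
      simpa using hm _

/-- Raising all letters by 1 frees the letter 0 for the marked minimum, here with multiplicity 0;
the condition `e j ≤ j` becomes slack 1. -/
theorem mem_avoidingInvSeq_iff {n m : ℕ} (e : Fin n → ℕ) :
    e ∈ avoidingInvSeq n m ↔ List.ofFn (fun j => 1 + e j) ∈ wordClass 0 0 (HasSlack 1) ∧
      listWeight (List.ofFn fun j => 1 + e j) = Finsupp.single 0 n + Finsupp.single 1 m := by
  have h102 : ContainsPattern e ![1, 0, 2] ↔ ¬ Avoids102 (List.ofFn fun j => 1 + e j) := by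
    rw [avoids102_ofFn, containsPattern_three_iff]
    push Not
    simp [wordReduction_eq_102_iff]
  have h000 : ContainsPattern e ![0, 0, 0] ↔
      ContainsPattern (fun j => 1 + e j) ![0, 0, 0] := by
    rw [containsPattern_three_iff, containsPattern_three_iff]
    simp [wordReduction_eq_000_iff]
  have hw : listWeight (List.ofFn fun j => 1 + e j) = Finsupp.single 0 n + Finsupp.single 1 m ↔
      seqDist e = m := by
    have : (List.ofFn fun j => 1 + e j).toFinset = (Finset.univ.image e).image (1 + ·) := by
      ext v; simp [List.mem_ofFn]
    rw [listWeight, this, Finset.card_image_of_injective _ (add_right_injective 1),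
      List.length_ofFn, add_right_inj, (Finsupp.single_injective 1).eq_iff]
    rfl
  rw [hw, wordClass, Set.mem_ofPred_eq, count_ofFn_le_two_iff, ← h000, hasSlack_ofFn,
    avoidingInvSeq, Set.mem_ofPred_eq, h102, not_not, IsInversionSeq]
  simp only [Nat.zero_le, implies_true, true_and, add_le_add_iff_left]
  have h0 : (List.ofFn fun j => 1 + e j).count 0 = 0 := by
    rw [List.count_eq_zero]; simp [List.mem_ofFn]
  tauto

theorem genE_eq_slackGF : genE = slackGF 0 1 := by
  ext s
  have hs : Finsupp.single 0 (s 0) + Finsupp.single 1 (s 1) = s := by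
    ext i; fin_cases i <;> simp
  have key : wordClass 0 0 (HasSlack 1) ∩ listWeight ⁻¹' {s} =
      (fun (e : Fin (s 0) → ℕ) => List.ofFn fun j => 1 + e j) '' avoidingInvSeq (s 0) (s 1) := by
    ext l
    constructor
    · rintro ⟨hl, hw⟩
      have hw : listWeight l = s := hw
      have hlen : l.length = s 0 := by
        rw [← hw]; simp [listWeight]
      have h1 : ∀ v ∈ l, 1 ≤ v := fun v hv => Nat.one_le_iff_ne_zero.2 fun h0 =>
        List.count_eq_zero.1 hl.2.2.1 (h0 ▸ hv)
      -- The truncated subtraction is harmless because every letter is at least 1.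
      have e : List.ofFn (fun j : Fin (s 0) => 1 + (l.get (j.cast hlen.symm) - 1)) = l := by
        refine List.ext_getElem (by simp [hlen]) fun i h h' => ?_
        have := h1 _ (List.getElem_mem h')
        simp; omega
      refine ⟨fun j => l.get (j.cast hlen.symm) - 1, (mem_avoidingInvSeq_iff _).2 ?_, e⟩
      rw [e, hs]
      exact ⟨hl, hw⟩
    · rintro ⟨e, he, rfl⟩
      have := (mem_avoidingInvSeq_iff e).1 he
      rw [hs] at this
      exact this
  have hinj : Function.Injective
      (fun (e : Fin (s 0) → ℕ) => List.ofFn fun j => 1 + e j) := by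
    intro e e' h
    have := List.ofFn_injective h
    funext j
    simpa using congrFun this j
  rw [slackGF, coeff_weightGF, key, Set.ncard_image_of_injective _ hinj]
  rfl

/-! ### Functional equations and the kernel method -/

section

open PowerSeries

theorem coeff_X_mul_mk_mul_mk {R : Type*} [CommRing R] (f g : ℕ → R) (N : ℕ) :
    coeff N (X * (mk f * mk g)) = ∑ k ∈ Finset.range N, f (N - 1 - k) * g k := by
  cases N with
  | zero => simp
  | succ n =>
    rw [coeff_succ_X_mul, mul_comm (mk f), coeff_mul,
      Finset.Nat.sum_antidiagonal_eq_sum_range_succ_mk]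
    refine Finset.sum_congr rfl fun k _ => ?_
    rw [coeff_mk, coeff_mk, mul_comm, Nat.add_sub_cancel]

/-- The generating function of `boxGF i j` in the number of letters. -/
noncomputable def boxSeries (i j : ℕ) : PowerSeries (MvPowerSeries (Fin 2) ℚ) := mk (boxGF i j)

/-- The generating function of `slackGF i (N + 1)` in `N`. -/
noncomputable def slackSeries (i : ℕ) : PowerSeries (MvPowerSeries (Fin 2) ℚ) :=
  mk fun N => slackGF i (N + 1)

/-- The variable `x` as a constant series. -/
noncomputable def xC : PowerSeries (MvPowerSeries (Fin 2) ℚ) := C (MvPowerSeries.X 0)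

/-- The variable `y` as a constant series. -/
noncomputable def yC : PowerSeries (MvPowerSeries (Fin 2) ℚ) := C (MvPowerSeries.X 1)

theorem coeff_split_sum (f₀ f₁ g₀ g₁ : ℕ → MvPowerSeries (Fin 2) ℚ) (N : ℕ) :
    coeff N (X * (xC * yC * mk f₀ * mk g₀ + xC * mk f₁ * mk g₀ +
      xC * mk f₀ * (mk g₁ - xC * yC * mk g₀))) =
    ∑ k ∈ Finset.range N,
      (MvPowerSeries.X 0 * MvPowerSeries.X 1 * (f₀ (N - 1 - k) * g₀ k) +
        MvPowerSeries.X 0 * (f₁ (N - 1 - k) * g₀ k) +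
        MvPowerSeries.X 0 * (f₀ (N - 1 - k) *
          (g₁ k - MvPowerSeries.X 0 * MvPowerSeries.X 1 * g₀ k))) := by
  have e : X * (xC * yC * mk f₀ * mk g₀ + xC * mk f₁ * mk g₀ +
      xC * mk f₀ * (mk g₁ - xC * yC * mk g₀)) =
      C (MvPowerSeries.X 0 * MvPowerSeries.X 1) * (X * (mk f₀ * mk g₀)) +
      C (MvPowerSeries.X 0) * (X * (mk f₁ * mk g₀)) +
      C (MvPowerSeries.X 0) * (X * (mk f₀ * mk g₁)) -
      C (MvPowerSeries.X 0) * (C (MvPowerSeries.X 0 * MvPowerSeries.X 1) *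
        (X * (mk f₀ * mk g₀))) := by
    rw [xC, yC, map_mul]; ring
  rw [e]
  simp only [map_add, map_sub, coeff_C_mul, coeff_X_mul_mk_mul_mk, Finset.mul_sum,
    ← Finset.sum_add_distrib, ← Finset.sum_sub_distrib]
  exact Finset.sum_congr rfl fun k _ => by ring

theorem one_sub_X_mul_mk_one : (1 - X : PowerSeries (MvPowerSeries (Fin 2) ℚ)) * mk 1 = 1 := by
  rw [mul_comm]; exact mk_one_mul_one_sub_eq_one _

theorem boxSeries_eq {i j : ℕ} (hi : i ≤ 1) (hj : j ≤ 1) :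
    boxSeries i j = (if i = 0 ∧ j = 0 then mk 1 else 0) +
      ((if i = 1 then xC * yC * boxSeries 0 j else 0) +
      ((if j = 1 then xC * yC * boxSeries i 0 else 0) +
      X * (xC * yC * boxSeries 0 j * boxSeries i 0 + xC * boxSeries 1 j * boxSeries i 0 +
        xC * boxSeries 0 j * (boxSeries i 1 - xC * yC * boxSeries i 0)))) := by
  ext1 N
  have hxy : ∀ f, coeff N (xC * yC * mk f) = MvPowerSeries.X 0 * MvPowerSeries.X 1 * f N := by
    intro f
    rw [xC, yC, ← map_mul, coeff_C_mul, coeff_mk]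
  simp only [map_add, boxSeries, coeff_split_sum, apply_ite (coeff N), hxy]
  rw [coeff_mk, boxGF_rec N hi hj]
  simp

theorem slackSeries_zero_eq :
    slackSeries 0 = mk 1 +
      (xC * yC * slackSeries 0 * boxSeries 0 0 + xC * slackSeries 1 * boxSeries 0 0 +
        xC * slackSeries 0 * (boxSeries 0 1 - xC * yC * boxSeries 0 0)) := by
  ext1 N
  -- The index is `N + 1` because `slackSeries` is shifted by one; this also cancels the factor `X`.
  have h := coeff_split_sum (fun N => slackGF 0 (N + 1)) (fun N => slackGF 1 (N + 1)) (boxGF 0 0)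
    (boxGF 0 1) (N + 1)
  rw [coeff_succ_X_mul] at h
  rw [map_add, slackSeries, slackSeries, boxSeries, boxSeries, h, coeff_mk,
    slackGF_rec (N + 1) (by omega)]
  simp

/-- The shift by one in `slackSeries` makes E appear: at order 0 both sides are xy times `slackGF 0
1`, and from order 1 on this is the recursion. -/
theorem slackSeries_one_eq :
    xC * yC * C (slackGF 0 1) + X * slackSeries 1 = xC * yC * slackSeries 0 +
      X * (xC * yC * slackSeries 0 * boxSeries 1 0 + xC * slackSeries 1 * boxSeries 1 0 +
        xC * slackSeries 0 * (boxSeries 1 1 - xC * yC * boxSeries 1 0)) := by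
  ext1 N
  have hxy : ∀ f, coeff N (xC * yC * f) =
      MvPowerSeries.X 0 * MvPowerSeries.X 1 * coeff N f := by
    intro f
    rw [xC, yC, ← map_mul, coeff_C_mul]
  rw [map_add, map_add, hxy, hxy, slackSeries, slackSeries, boxSeries, boxSeries,
    coeff_split_sum]
  have := slackGF_rec N (i := 1) le_rfl
  cases N with
  | zero => simp
  | succ n =>
    rw [coeff_C, if_neg (Nat.succ_ne_zero n), coeff_succ_X_mul, coeff_mk, coeff_mk, this]
    simp

theorem aeval_genE_polyE : Polynomial.aeval genE polyE = 0 := by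
  set t : PowerSeries (MvPowerSeries (Fin 2) ℚ) := X with ht
  set a := boxSeries 0 0 with ha
  set b := boxSeries 1 0 with hb
  set c := boxSeries 0 1 with hc
  set d := boxSeries 1 1 with hd
  have h00 := boxSeries_eq (i := 0) (j := 0) (by omega) (by omega)
  have h10 := boxSeries_eq (i := 1) (j := 0) (by omega) (by omega)
  have h01 := boxSeries_eq (i := 0) (j := 1) (by omega) (by omega)
  have h11 := boxSeries_eq (i := 1) (j := 1) (by omega) (by omega)
  have s0 := slackSeries_zero_eq
  have s1 := slackSeries_one_eq
  have hm := one_sub_X_mul_mk_one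
  simp only [and_self, if_true, if_false, one_ne_zero, zero_ne_one, and_true, and_false,
    zero_add, ← ha, ← hb, ← hc, ← hd, ← ht] at h00 h10 h01 h11 s0 s1 hm
  have hpoly : Polynomial.aeval genE polyE =
      (1 + MvPowerSeries.X 0 * MvPowerSeries.X 1 * (1 - MvPowerSeries.X 0) * genE +
        MvPowerSeries.X 0 ^ 2 * MvPowerSeries.X 1 * genE * genE) ^ 2 -
      genE * (1 + MvPowerSeries.X 0 * MvPowerSeries.X 1 * (1 - MvPowerSeries.X 0) * genE) := by
    have hX : ∀ i : Fin 2, algebraMap (MvPolynomial (Fin 2) ℚ) (MvPowerSeries (Fin 2) ℚ)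
        (MvPolynomial.X i) = MvPowerSeries.X i := by
      intro i; simp [MvPowerSeries.algebraMap_apply']
    simp only [polyE, map_add, map_sub, map_mul, map_one, map_pow, Polynomial.aeval_C,
      Polynomial.aeval_X, hX, map_neg, map_ofNat]
    ring
  -- The kernel: the determinant of the linear system for the two slack series.
  set g := t * (1 - (xC * yC * a + xC * (c - xC * yC * a))) * (1 - xC * b) -
    xC * a * (xC * yC + t * (xC * yC * b + xC * (d - xC * yC * b))) with hg
  have hgk : g = X + C (MvPowerSeries.X 0) *
      (-(t * ((yC * a + (c - xC * yC * a)) * (1 - xC * b) + b)) -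
        a * (xC * yC + t * (xC * yC * b + xC * (d - xC * yC * b)))) := by
    change g = t + xC * _
    rw [hg]; ring
  rw [← genE_eq_slackGF] at s1
  -- Working modulo `g` replaces the substitution of the root of the kernel for `t`.
  set q := Ideal.Quotient.mk (Ideal.span {g}) with hq
  have hqg : q g = 0 := Ideal.Quotient.eq_zero_iff_mem.2 (Ideal.mem_span_singleton_self g)
  -- Multiply `s0` by `t * (1 - xC * b)` and `s1` by `xC * a`, so that `slackSeries 1` cancels.
  have elim : slackSeries 0 * g * (1 - t) =
      t * (1 - xC * b) - xC ^ 2 * yC * C genE * a * (1 - t) := by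
    rw [hg]
    linear_combination (1 - t) * t * (1 - xC * b) * s0 + (1 - t) * xC * a * s1 +
      t * (1 - xC * b) * hm
  have main := quartic_of_kernel (x := q xC) (y := q yC) (t := q t) (E := q (C genE)) (a := q a)
    (b := q b) (c := q c) (d := q d)
    (by
      have : IsUnit (1 - t) := IsUnit.of_mul_eq_one _ hm
      simpa only [map_sub, map_one] using this.map q)
    (by
      have : IsUnit (1 - t * (xC * b)) := by
        rw [isUnit_iff_constantCoeff]; simp [ht]
      simpa only [map_sub, map_one, map_mul] using this.map q)
    (by
      have : (1 - t) * a = 1 + (1 - t) * (t * (xC * yC * a * a + xC * b * a +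
          xC * a * (c - xC * yC * a))) := by
        linear_combination (1 - t) * h00 + hm
      simpa only [map_sub, map_one, map_mul, map_add] using congrArg q this)
    (by
      have : b = xC * yC * a + t * (xC * yC * a * b + xC * b * b +
          xC * a * (d - xC * yC * b)) := h10
      simpa only [map_sub, map_one, map_mul, map_add] using congrArg q this)
    (by
      have : c - xC * yC * a = t * (xC * yC * c * a + xC * d * a +
          xC * c * (c - xC * yC * a)) := by
        linear_combination h01
      simpa only [map_sub, map_one, map_mul, map_add] using congrArg q this)
    (by
      have : d - xC * yC * b = xC * yC * c + t * (xC * yC * c * b + xC * d * b +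
          xC * c * (d - xC * yC * b)) := by
        linear_combination h11
      simpa only [map_sub, map_one, map_mul, map_add] using congrArg q this)
    (by
      rw [← sub_eq_zero]
      simpa only [hg, map_sub, map_one, map_mul, map_add] using hqg)
    (by
      have := congrArg q elim
      rw [map_mul, map_mul, hqg, mul_zero, zero_mul, map_sub] at this
      have := (sub_eq_zero.1 this.symm).symm
      simpa only [map_sub, map_one, map_mul, map_add, map_pow] using this)
  rw [hpoly]
  set p := (1 + MvPowerSeries.X 0 * MvPowerSeries.X 1 * (1 - MvPowerSeries.X 0) * genE +
        MvPowerSeries.X 0 ^ 2 * MvPowerSeries.X 1 * genE * genE) ^ 2 -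
      genE * (1 + MvPowerSeries.X 0 * MvPowerSeries.X 1 * (1 - MvPowerSeries.X 0) * genE) with hp
  have hmem : q (C ((MvPowerSeries.X 0 ^ 2 * MvPowerSeries.X 1) ^ 2 * p)) = 0 := by
    rw [← main, hp]
    simp only [xC, yC, map_sub, map_one, map_mul, map_add, map_pow]
  -- A series free of `t` is a multiple of `g`, which has the form `t` plus a multiple of x; hence
  -- all powers of x divide it and it vanishes.
  obtain ⟨h, hh⟩ := Ideal.mem_span_singleton.1 (Ideal.Quotient.eq_zero_iff_mem.1 hmem)
  rw [hgk] at hh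
  have hX : ∀ i : Fin 2, (MvPowerSeries.X i : MvPowerSeries (Fin 2) ℚ) ≠ 0 :=
    fun i h => by
      have := congrArg (MvPowerSeries.coeff (Finsupp.single i 1)) h
      simp [MvPowerSeries.coeff_index_single_self_X] at this
  have : IsDomain (MvPowerSeries (Fin 2) ℚ) := NoZeroDivisors.to_isDomain _
  have hz := eq_zero_of_X_pow_dvd fun n => pow_dvd_of_C_eq_mul (hX 0) _ n _ h hh
  refine (mul_eq_zero.1 hz).resolve_left ?_
  exact pow_ne_zero _ (mul_ne_zero (pow_ne_zero _ (hX 0)) (hX 1))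

end

theorem mainTheorem6 :
    IsAlgebraic RatField (algebraMap (MvPowerSeries (Fin 2) ℚ) SeriesField genE) ∧
    Polynomial.aeval genE polyE = 0 ∧
    Irreducible polyE ∧
    Polynomial.map (algebraMap (MvPolynomial (Fin 2) ℚ) RatField) polyE =
      Polynomial.C (algebraMap (MvPolynomial (Fin 2) ℚ) RatField polyE.leadingCoeff) *
        minpoly RatField (algebraMap (MvPowerSeries (Fin 2) ℚ) SeriesField genE) := by
  obtain ⟨h1, h2⟩ := isAlgebraic_and_map_polyE_of_aeval_eq_zero aeval_genE_polyE
  exact ⟨h1, aeval_genE_polyE, irreducible_polyE, h2⟩
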